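/- **Theorem (A-B-P maximum principle).** Let $n\ge 1$, $0<\lambda\le\Lambda$ and $\delta_1>0$. There is a constant $C>0$ depending only on $n,\lambda,\Lambda,\delta_1$ with the following property. Let $\Omega\subset B_1\subset\mathbb R^n$ be open, let $\Gamma\subset\partial\Omega$, let $f\in C(\Omega)$, and let $\beta:\Gamma\to\mathbb R^n$, $\gamma,g:\Gamma\to\mathbb R$ be functions with $|\beta|\le 1$ and $\gamma\le 0$ on $\Gamma$. Suppose that there is a unit vector $\xi$ with $\beta\cdot\xi\ge\delta_1$ on $\Gamma$. Let $u:\overline\Omega\to\mathbb R$ be lower semicontinuous and satisfy, in the viscosity sense, $$u\in\bar S(\lambda,\Lambda,f)\ \text{ in }\Omega,\qquad \beta\cdot Du+\gamma u\le g\ \text{ on }\Gamma .$$ Then $$\sup_\Omega u^-\le \sup_{\partial\Omega\setminus\Gamma}u^-+C\,\sup_\Gamma g^++C\,\|f^+\|_{L^n(\{u=\Gamma_u\})}$$ as an inequality in $[0,\infty]$, where suprema over the empty set are $0$, $a^+=\max\{0,a\}$ and $a^-=-\min\{0,a\}$. Here $\varphi$ touches $u$ by below at $x_0$ in $S$ if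 $x_0\in S$, $\varphi\le u$ in $S$ and $\varphi(x_0)=u(x_0)$. The first condition means that $M^-(D^2\varphi(x_0),\lambda,\Lambda)\le f(x_0)$ whenever $\varphi\in C^2(\Omega)$ touches $u$ by below at $x_0$ in $\Omega$, where $M^-(M,\lambda,\Lambda)=\inf\{\operatorname{tr}(AM): A \text{ symmetric},\ \lambda I\le A\le\Lambda I\}$, i.e. $\lambda$ times the sum of the positive eigenvalues of the symmetric matrix $M$ plus $\Lambda$ times the sum of the negative ones. The second means that $\beta(x_0)\cdot D\varphi(x_0)+\gamma(x_0)\varphi(x_0)\le g(x_0)$ whenever $x_0\in\Gamma$ and $\varphi\in C^2(\Omega\cup\Gamma)$ (that is, $\varphi$ is $C^2$ in a neighbourhood of $\Omega\cup\Gamma$) touches $u$ by below at $x_0$ in $\Omega\cup\Gamma$. Finally, $\Gamma_u(x)=\sup\{L(x): L\text{ affine},\ L\le u\text{ in }\Omega\}$ is the convex envelope of $u$ in $\Omega$, and $\{u=\Gamma_u\}=\{x\in\Omega: u(x)=\Gamma_u(x)\}$. -/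

import Mathlib

open MeasureTheory
open scoped ENNReal NNReal

/-- The Hessian matrix of `φ` at `x`, with entries `D_{ij} φ (x)`. -/
noncomputable def hessianMatrix {n : ℕ} (φ : EuclideanSpace ℝ (Fin n) → ℝ)
    (x : EuclideanSpace ℝ (Fin n)) : Matrix (Fin n) (Fin n) ℝ :=
  Matrix.of fun i j =>
    fderiv ℝ (fderiv ℝ φ) x (EuclideanSpace.single i 1) (EuclideanSpace.single j 1)

/-- The Pucci extremal operator `M⁻(M, lam, Lam)`: the infimum of `tr (A M)` over all symmetric
matrices `A` with `lam I ≤ A ≤ Lam I`. For symmetric `M` this is `lam` times the sum of the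
positive eigenvalues of `M` plus `Lam` times the sum of the negative ones. -/
noncomputable def pucciMin {n : ℕ} (lam Lam : ℝ) (M : Matrix (Fin n) (Fin n) ℝ) : ℝ :=
  sInf {t : ℝ | ∃ A : Matrix (Fin n) (Fin n) ℝ,
    (A - lam • (1 : Matrix (Fin n) (Fin n) ℝ)).PosSemidef ∧
    (Lam • (1 : Matrix (Fin n) (Fin n) ℝ) - A).PosSemidef ∧ t = (A * M).trace}

/-- `φ` touches `u` by below at `x₀` in `S`. -/
def TouchesBelowAt {n : ℕ} (φ u : EuclideanSpace ℝ (Fin n) → ℝ)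
    (S : Set (EuclideanSpace ℝ (Fin n))) (x₀ : EuclideanSpace ℝ (Fin n)) : Prop :=
  x₀ ∈ S ∧ (∀ x ∈ S, φ x ≤ u x) ∧ φ x₀ = u x₀

/-- `φ ∈ C²(S)`: `φ` is twice continuously differentiable in a neighbourhood of each point
of `S`. -/
def IsC2On {n : ℕ} (φ : EuclideanSpace ℝ (Fin n) → ℝ)
    (S : Set (EuclideanSpace ℝ (Fin n))) : Prop :=
  ∀ x ∈ S, ContDiffAt ℝ 2 φ x

/-- The class `S̄(lam, Lam, f)` in `Ω`: lower semicontinuous functions `u` satisfying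
`M⁻(D²u, lam, Lam) ≤ f` in `Ω` in the viscosity sense. -/
def MemSBar {n : ℕ} (lam Lam : ℝ) (f : EuclideanSpace ℝ (Fin n) → ℝ)
    (Ω : Set (EuclideanSpace ℝ (Fin n))) (u : EuclideanSpace ℝ (Fin n) → ℝ) : Prop :=
  LowerSemicontinuousOn u Ω ∧
  ∀ (φ : EuclideanSpace ℝ (Fin n) → ℝ) (x₀ : EuclideanSpace ℝ (Fin n)),
    IsC2On φ Ω → TouchesBelowAt φ u Ω x₀ →
    pucciMin lam Lam (hessianMatrix φ x₀) ≤ f x₀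

/-- The boundary inequality `β · Du + γ u ≤ g` on `Γ ⊆ ∂Ω` in the viscosity sense: it holds at
`x₀ ∈ Γ` for every `φ ∈ C²(Ω ∪ Γ)` touching `u` by below at `x₀` in `Ω ∪ Γ`.
The term `fderiv ℝ φ x₀ (β x₀)` is `β(x₀) · Dφ(x₀)`. -/
def ObliqueLE {n : ℕ} (β : EuclideanSpace ℝ (Fin n) → EuclideanSpace ℝ (Fin n))
    (γ g : EuclideanSpace ℝ (Fin n) → ℝ) (Ω Γ : Set (EuclideanSpace ℝ (Fin n)))
    (u : EuclideanSpace ℝ (Fin n) → ℝ) : Prop :=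
  LowerSemicontinuousOn u (Ω ∪ Γ) ∧
  ∀ (φ : EuclideanSpace ℝ (Fin n) → ℝ) (x₀ : EuclideanSpace ℝ (Fin n)),
    IsC2On φ (Ω ∪ Γ) → x₀ ∈ Γ → TouchesBelowAt φ u (Ω ∪ Γ) x₀ →
    fderiv ℝ φ x₀ (β x₀) + γ x₀ * φ x₀ ≤ g x₀

/-- The convex envelope of `u` in `Ω`: the supremum of the affine functions
`L(x) = p · x + c` with `L ≤ u` in `Ω`. -/
noncomputable def convexEnvelope {n : ℕ} (Ω : Set (EuclideanSpace ℝ (Fin n)))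
    (u : EuclideanSpace ℝ (Fin n) → ℝ) (x : EuclideanSpace ℝ (Fin n)) : ℝ :=
  sSup {t : ℝ | ∃ (p : EuclideanSpace ℝ (Fin n)) (c : ℝ),
    (∀ y ∈ Ω, inner ℝ p y + c ≤ u y) ∧ t = inner ℝ p x + c}

/-- The contact set `{u = Γ_u}` in `Ω`. -/
def contactSet {n : ℕ} (Ω : Set (EuclideanSpace ℝ (Fin n)))
    (u : EuclideanSpace ℝ (Fin n) → ℝ) : Set (EuclideanSpace ℝ (Fin n)) :=
  {x | x ∈ Ω ∧ u x = convexEnvelope Ω u x}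

/-- The supremum over `S` of the positive part of `h`, in `[0, ∞]` (it is `0` for empty `S`). -/
noncomputable def supPos {n : ℕ} (S : Set (EuclideanSpace ℝ (Fin n)))
    (h : EuclideanSpace ℝ (Fin n) → ℝ) : ℝ≥0∞ :=
  ⨆ x ∈ S, ENNReal.ofReal (max (h x) 0)

/-- The supremum over `S` of the negative part `h⁻ = -min (0, h)`, in `[0, ∞]`
(it is `0` for empty `S`). -/
noncomputable def supNeg {n : ℕ} (S : Set (EuclideanSpace ℝ (Fin n)))
    (h : EuclideanSpace ℝ (Fin n) → ℝ) : ℝ≥0∞ :=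
  ⨆ x ∈ S, ENNReal.ofReal (-min 0 (h x))

/-! Let `M` be the excess of `u⁻` at a point of `Ω` over its supremum on the boundary off `Γ`.
Unless `g⁺` is comparable to `M` somewhere on `Γ`, every `p` in a ball of radius proportional to `M`
centred at `(M / 4) • ξ` is the slope of an affine function touching `u` by below inside `Ω`: a
minimizer of `u - p · x` can lie neither off `Γ`, because `p` is short, nor on `Γ`, because `p · β >
g` (`exists_isSupportingSlope`).

The volume of the slopes is bounded without differentiating the convex envelope. If slopes at two
nearby contact points differ too much, `u` lies above a sharp convex wedge while being low at its
bottom, so a strongly convex quadratic touches it by below and violates `M⁻ ≤ f`. Hence slopes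
depend on the contact point in a locally Lipschitz way, with constant about `12 f⁺ / lam`
(`norm_sub_le_of_isSupportingSlope`). Summing over small pieces bounds the volume by `∫ (f⁺)^n` over
the contact set (`volume_supportingSlopes_le`); comparison with the ball gives the estimate. -/

section

variable {n : ℕ}

/-! ### Quadratic test functions and the Pucci operator. -/

/-- A rank-one quadratic form minus a multiple of the squared distance, plus an affine function. -/
noncomputable def axialQuadratic (A B c : ℝ) (e x₀ w x : EuclideanSpace ℝ (Fin n)) : ℝ :=
  A * inner ℝ e (x - x₀) ^ 2 - B * inner ℝ (x - x₀) (x - x₀) + inner ℝ w x + c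

theorem contDiff_axialQuadratic (A B c : ℝ) (e x₀ w : EuclideanSpace ℝ (Fin n)) :
    ContDiff ℝ 2 (axialQuadratic A B c e x₀ w) := by
  have h : ContDiff ℝ 2 fun x : EuclideanSpace ℝ (Fin n) => x - x₀ := contDiff_id.sub contDiff_const
  exact ((((contDiff_const.mul ((contDiff_const.inner ℝ h).pow 2)).sub
    (contDiff_const.mul (h.inner ℝ h))).add (contDiff_const.inner ℝ contDiff_id)).add contDiff_const)

theorem hasFDerivAt_sub_center (x₀ x : EuclideanSpace ℝ (Fin n)) :
    HasFDerivAt (fun x => x - x₀) (ContinuousLinearMap.id ℝ (EuclideanSpace ℝ (Fin n))) x :=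
  (hasFDerivAt_id x).sub_const x₀

theorem hasFDerivAt_inner_sub (e x₀ x : EuclideanSpace ℝ (Fin n)) :
    HasFDerivAt (fun x => inner ℝ e (x - x₀)) (innerSL ℝ e) x :=
  HasFDerivAt.comp (g := fun y => inner ℝ e y) x (innerSL ℝ e).hasFDerivAt
    (hasFDerivAt_sub_center x₀ x)

theorem fderiv_axialQuadratic (A B c : ℝ) (e x₀ w : EuclideanSpace ℝ (Fin n)) :
    fderiv ℝ (axialQuadratic A B c e x₀ w) = fun x =>
      (2 * A * inner ℝ e (x - x₀)) • innerSL ℝ e - (2 * B) • innerSL ℝ (x - x₀) + innerSL ℝ w := by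
  funext x
  have hid := hasFDerivAt_sub_center x₀ x
  have he := hasFDerivAt_inner_sub e x₀ x
  have hw : HasFDerivAt (fun x => inner ℝ w x) (innerSL ℝ w) x := (innerSL ℝ w).hasFDerivAt
  have h := ((((he.pow 2).const_mul A).sub ((hid.inner ℝ hid).const_mul B)).add hw).add_const c
  refine HasFDerivAt.fderiv (h.congr_fderiv ?_)
  ext v
  simp [real_inner_comm v, inner_sub_right]
  ring

theorem hessianMatrix_axialQuadratic (A B c : ℝ) (e x₀ w x : EuclideanSpace ℝ (Fin n)) :
    hessianMatrix (axialQuadratic A B c e x₀ w) x =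
      (2 * A) • Matrix.vecMulVec e e - (2 * B) • 1 := by
  -- Over ℝ the conjugate-linear `innerSL` is linear; `J` gives it that type.
  obtain ⟨J, hJ⟩ : ∃ J : EuclideanSpace ℝ (Fin n) →L[ℝ] EuclideanSpace ℝ (Fin n) →L[ℝ] ℝ,
      ∀ x, J x = innerSL ℝ x := ⟨innerSL ℝ, fun _ => rfl⟩
  have h : HasFDerivAt (fderiv ℝ (axialQuadratic A B c e x₀ w))
      ((2 * A) • (innerSL ℝ e).smulRight (innerSL ℝ e) - (2 * B) • J) x := by
    rw [fderiv_axialQuadratic]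
    have hid := hasFDerivAt_sub_center x₀ x
    have he := hasFDerivAt_inner_sub e x₀ x
    have hi : HasFDerivAt (fun x => innerSL ℝ (x - x₀)) J x := by
      simp only [← hJ]
      exact HasFDerivAt.comp (g := J) x J.hasFDerivAt hid
    have h := (((he.const_mul (2 * A)).smul_const (innerSL ℝ e)).sub (hi.const_smul (2 * B))).add_const
      (innerSL ℝ w)
    refine h.congr_fderiv ?_
    ext v y
    simp [mul_assoc]
  ext i j
  simp only [hessianMatrix, h.fderiv, Matrix.of_apply]
  simp [hJ, Matrix.vecMulVec_apply, Matrix.one_apply,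
    EuclideanSpace.inner_single_right, eq_comm, mul_assoc]

/-- The trace against an admissible `S` is `2A (e · S e) - 2B tr S`, where `e · S e ≥ lam` and `tr S
≤ n Lam`. -/
theorem le_pucciMin_axialQuadratic {lam Lam A B : ℝ} (hLam : lam ≤ Lam) (hA : 0 ≤ A) (hB : 0 ≤ B)
    {e : EuclideanSpace ℝ (Fin n)} (he : ‖e‖ = 1) (c : ℝ) (x₀ w x : EuclideanSpace ℝ (Fin n)) :
    2 * (A * lam - B * (n * Lam)) ≤
      pucciMin lam Lam (hessianMatrix (axialQuadratic A B c e x₀ w) x) := by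
  rw [hessianMatrix_axialQuadratic]
  refine le_csInf ?_ ?_
  · refine ⟨_, lam • 1, ?_, ?_, rfl⟩
    · simpa using Matrix.PosSemidef.zero
    · rw [← sub_smul]
      exact Matrix.PosSemidef.one.smul (sub_nonneg.2 hLam)
  · rintro t ⟨S, hS₁, hS₂, rfl⟩
    have h₁ := hS₁.dotProduct_mulVec_nonneg (e : Fin n → ℝ)
    have h₂ := hS₂.trace_nonneg
    have he' : (e : Fin n → ℝ) ⬝ᵥ e = 1 := by
      have : inner ℝ e e = (1 : ℝ) := by rw [real_inner_self_eq_norm_sq, he]; norm_num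
      rwa [PiLp.inner_apply] at this
    simp only [star_trivial, Matrix.sub_mulVec, Matrix.smul_mulVec, Matrix.one_mulVec,
      dotProduct_sub, dotProduct_smul, he', smul_eq_mul, mul_one] at h₁
    simp only [Matrix.trace_sub, Matrix.trace_smul, Matrix.trace_one, Fintype.card_fin,
      smul_eq_mul] at h₂
    have h₃ : (S * ((2 * A) • Matrix.vecMulVec (e : Fin n → ℝ) e - (2 * B) • 1)).trace =
        2 * A * ((e : Fin n → ℝ) ⬝ᵥ S.mulVec e) - 2 * B * S.trace := by
      rw [mul_sub, Matrix.trace_sub, mul_smul_comm, mul_smul_comm, Matrix.trace_smul,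
        Matrix.trace_smul, mul_one, Matrix.mul_vecMulVec, Matrix.trace_vecMulVec, dotProduct_comm]
      rfl
    rw [h₃]
    nlinarith [mul_nonneg hA h₁, mul_nonneg hB h₂]

/-! ### Localization of viscosity test functions. -/

theorem hessianMatrix_congr {φ ψ : EuclideanSpace ℝ (Fin n) → ℝ} {x : EuclideanSpace ℝ (Fin n)}
    (h : φ =ᶠ[nhds x] ψ) : hessianMatrix φ x = hessianMatrix ψ x := by
  unfold hessianMatrix
  rw [(h.fderiv (𝕜 := ℝ)).fderiv_eq]

/-- Test functions for `MemSBar` need only touch `u` by below near the contact point when `u` is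
bounded below. -/
theorem MemSBar.pucciMin_le_of_eventually_le {lam Lam : ℝ} {f u φ : EuclideanSpace ℝ (Fin n) → ℝ}
    {Ω : Set (EuclideanSpace ℝ (Fin n))} (hu : MemSBar lam Lam f Ω u) (hbdd : BddBelow (u '' Ω))
    {x : EuclideanSpace ℝ (Fin n)} (hx : x ∈ Ω) (hφ : ContDiff ℝ 2 φ)
    (hle : ∀ᶠ y in nhds x, φ y ≤ u y) (heq : φ x = u x) :
    pucciMin lam Lam (hessianMatrix φ x) ≤ f x := by
  obtain ⟨m, hm⟩ := hbdd
  obtain ⟨ε, hε, hball⟩ := Metric.eventually_nhds_iff_ball.1 hle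
  let χ : ContDiffBump x := ⟨ε / 2, ε, by positivity, by linarith⟩
  -- Interpolating with the global lower bound `m` keeps the function below `u` on all of `Ω`.
  let ψ : EuclideanSpace ℝ (Fin n) → ℝ := fun y => χ y * φ y + (1 - χ y) * m
  have hχ : ContDiff ℝ 2 χ := χ.contDiff
  have hψ : ContDiff ℝ 2 ψ := (hχ.mul hφ).add ((contDiff_const.sub hχ).mul contDiff_const)
  have heqψ : ψ =ᶠ[nhds x] φ := by
    filter_upwards [χ.eventuallyEq_one] with y hy
    simp [ψ, hy]
  have h := hu.2 ψ x (fun y _ => hψ.contDiffAt) ⟨hx, fun y hy => ?_, heqψ.self_of_nhds.trans heq⟩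
  · rwa [hessianMatrix_congr heqψ] at h
  · have hmy : m ≤ u y := hm ⟨y, hy, rfl⟩
    have h₁ := χ.le_one (x := y)
    by_cases hyb : y ∈ Metric.ball x ε
    · have h₂ := mul_le_mul_of_nonneg_left (hball y hyb) (χ.nonneg (x := y))
      have h₃ := mul_le_mul_of_nonneg_left hmy (sub_nonneg.2 h₁)
      simp only [ψ]
      linarith
    · have : χ y = 0 := χ.zero_of_le_dist (by simpa [χ] using hyb)
      simpa [ψ, this] using hmy

/-! ### Supporting slopes are locally Lipschitz in the contact point. -/

/-- `p` is the slope of an affine function touching `u` by below at `y` in `Ω`. -/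
def IsSupportingSlope (Ω : Set (EuclideanSpace ℝ (Fin n))) (u : EuclideanSpace ℝ (Fin n) → ℝ)
    (y p : EuclideanSpace ℝ (Fin n)) : Prop :=
  ∀ z ∈ Ω, u y + inner ℝ p (z - y) ≤ u z

theorem IsSupportingSlope.mem_contactSet {Ω : Set (EuclideanSpace ℝ (Fin n))}
    {u : EuclideanSpace ℝ (Fin n) → ℝ} {y p : EuclideanSpace ℝ (Fin n)} (hy : y ∈ Ω)
    (h : IsSupportingSlope Ω u y p) : y ∈ contactSet Ω u := by
  refine ⟨hy, Eq.symm ?_⟩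
  unfold convexEnvelope
  refine IsGreatest.csSup_eq ⟨⟨p, u y - inner ℝ p y, fun z hz => ?_, by ring⟩, ?_⟩
  · have := h z hz
    rw [inner_sub_right] at this
    linarith
  · rintro t ⟨q, c, hq, rfl⟩
    exact hq y hy

/-- Subtract the supporting function at `x₀` and put `τ = e · (z - x₀)`, with `e` the direction of
`p₁ - p₀`: then `u ≥ max (0, P (τ - d))`, with value `0` at `x₀`. A quadratic convex along `e` and
slightly concave across it is slid up to `u`; its Pucci value is at least `P lam / (12 d)`. -/
theorem norm_sub_le_of_isSupportingSlope {lam Lam b d r K : ℝ}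
    {f u : EuclideanSpace ℝ (Fin n) → ℝ} {Ω : Set (EuclideanSpace ℝ (Fin n))}
    (hlam : 0 < lam) (hLam : lam ≤ Lam) (hb : 0 < b) (hbn : b * (n * Lam) ≤ lam / 24)
    (hu : MemSBar lam Lam f Ω u) (hbdd : BddBelow (u '' Ω))
    {x₀ x₁ p₀ p₁ : EuclideanSpace ℝ (Fin n)} (hx₁ : x₁ ∈ Ω)
    (hball : Metric.closedBall x₀ r ⊆ Ω) (hfK : ∀ x ∈ Metric.closedBall x₀ r, f x ≤ K) (hK : 0 ≤ K)
    (hp₀ : IsSupportingSlope Ω u x₀ p₀) (hp₁ : IsSupportingSlope Ω u x₁ p₁)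
    (hd : 0 < d) (hdist : ‖x₁ - x₀‖ ≤ d) (hr : 0 ≤ r) (hdr : d ^ 2 * (4 + 1 / b) ≤ r ^ 2) :
    ‖p₁ - p₀‖ ≤ 12 * K / lam * d := by
  rcases (norm_nonneg (p₁ - p₀)).eq_or_lt with hP | hP
  · rw [← hP]
    positivity
  set P := ‖p₁ - p₀‖ with hPdef
  set e := P⁻¹ • (p₁ - p₀) with hedef
  have he : ‖e‖ = 1 := by
    rw [hedef, norm_smul, norm_inv, Real.norm_of_nonneg hP.le, ← hPdef, inv_mul_cancel₀ hP.ne']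
  have hPe : p₁ - p₀ = P • e := by rw [hedef, smul_inv_smul₀ hP.ne']
  have hlow : ∀ z ∈ Ω, u x₀ + inner ℝ p₀ (z - x₀) + P * (inner ℝ e (z - x₀) - d) ≤ u z := by
    intro z hz
    have h₁ := hp₁ z hz
    have h₀ := hp₀ x₁ hx₁
    have h₂ : inner ℝ p₁ (z - x₁) =
        inner ℝ p₀ (z - x₀) - inner ℝ p₀ (x₁ - x₀) +
          P * (inner ℝ e (z - x₀) - inner ℝ e (x₁ - x₀)) := by
      rw [eq_add_of_sub_eq hPe, inner_add_left, inner_smul_left]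
      simp only [inner_sub_right, conj_trivial]
      ring
    have h₃ : inner ℝ e (x₁ - x₀) ≤ d :=
      (real_inner_le_norm _ _).trans (by rw [he, one_mul]; exact hdist)
    nlinarith
  let c := u x₀ - inner ℝ p₀ x₀ - P / 4 * inner ℝ e x₀ + P * d / 6
  -- The `e`-profile `(τ + d)(τ + 2d) / 12` vanishes at `τ = -2d`, equals `d²` at `τ = 2d`, where
  -- the wedge has height `P d`, and is positive at `τ = 0`. The term `-b σ` cancels it once `σ = d²
  -- / b`.
  let q := axialQuadratic (P / d * (1 / 12 + b)) (P / d * b) c e x₀ (p₀ + (P / 4) • e)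
  have hq : ∀ z, q z = u x₀ + inner ℝ p₀ (z - x₀) +
      P / d * (1 / 12 * (inner ℝ e (z - x₀) + d) * (inner ℝ e (z - x₀) + 2 * d) -
        b * (‖z - x₀‖ ^ 2 - inner ℝ e (z - x₀) ^ 2)) := by
    intro z
    simp only [q, c, axialQuadratic, real_inner_self_eq_norm_sq, inner_add_left, inner_smul_left,
      conj_trivial]
    have h₁ : inner ℝ e z = inner ℝ e (z - x₀) + inner ℝ e x₀ := by rw [inner_sub_right]; ring
    have h₂ : inner ℝ p₀ z = inner ℝ p₀ (z - x₀) + inner ℝ p₀ x₀ := by rw [inner_sub_right]; ring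
    rw [h₁, h₂]
    field_simp
    ring
  have hqc : Continuous q := (contDiff_axialQuadratic _ _ _ _ _ _).continuous
  have hτ : Continuous fun z : EuclideanSpace ℝ (Fin n) => inner ℝ e (z - x₀) := by fun_prop
  have hσ : Continuous fun z : EuclideanSpace ℝ (Fin n) =>
    ‖z - x₀‖ ^ 2 - inner ℝ e (z - x₀) ^ 2 := by fun_prop
  have hcs : ∀ z, 0 ≤ ‖z - x₀‖ ^ 2 - inner ℝ e (z - x₀) ^ 2 := by
    intro z
    have := abs_real_inner_le_norm e (z - x₀)
    rw [he, one_mul] at this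
    have := sq_le_sq' (abs_le.1 this).1 (abs_le.1 this).2
    linarith
  let D : Set (EuclideanSpace ℝ (Fin n)) := {z | |inner ℝ e (z - x₀)| ≤ 2 * d ∧
    ‖z - x₀‖ ^ 2 - inner ℝ e (z - x₀) ^ 2 ≤ d ^ 2 / b}
  have hDball : D ⊆ Metric.closedBall x₀ r := by
    rintro z ⟨h₁, h₂⟩
    rw [mem_closedBall_iff_norm]
    have h₃ := sq_le_sq' (abs_le.1 h₁).1 (abs_le.1 h₁).2
    refine abs_le_of_sq_le_sq' ?_ hr |>.2
    have : d ^ 2 * (4 + 1 / b) = 4 * d ^ 2 + d ^ 2 / b := by ring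
    nlinarith
  have hDc : IsCompact D :=
    (isCompact_closedBall x₀ r).of_isClosed_subset
      ((isClosed_le hτ.abs continuous_const).inter (isClosed_le hσ continuous_const)) hDball
  have hx₀D : x₀ ∈ D := by
    refine ⟨?_, ?_⟩ <;> simp <;> positivity
  have hlsc : LowerSemicontinuousOn (fun z => u z + -q z) D :=
    (hu.1.mono (hDball.trans hball)).add hqc.neg.continuousOn.lowerSemicontinuousOn
  obtain ⟨z, hzD, hzmin⟩ := hlsc.exists_isMinOn ⟨x₀, hx₀D⟩ hDc
  have hneg : u z - q z < 0 := by
    have h₁ : u z + -q z ≤ u x₀ + -q x₀ := hzmin hx₀D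
    have h₂ : q x₀ = u x₀ + P * d / 6 := by
      rw [hq]
      simp
      field_simp
      ring
    have : 0 < P * d / 6 := by positivity
    linarith
  have hzΩ : z ∈ Ω := hball (hDball hzD)
  have hz₀ := hp₀ z hzΩ
  have hz₁ := hlow z hzΩ
  rw [hq] at hneg
  have hPd : 0 < P / d := by positivity
  obtain ⟨hzτ, hzσ⟩ := hzD
  obtain ⟨hτ₁, hτ₂⟩ := abs_le.1 hzτ
  have hσ₀ := mul_nonneg hb.le (hcs z)
  set τ := inner ℝ e (z - x₀)
  set σ := ‖z - x₀‖ ^ 2 - τ ^ 2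
  -- The minimizer has `u < q` although `u` lies above both affine functions; this excludes each
  -- face of `D`, so contact is interior.
  have hpos : 0 < 1 / 12 * (τ + d) * (τ + 2 * d) - b * σ := by
    by_contra! h
    have := mul_nonpos_of_nonneg_of_nonpos hPd.le h
    linarith
  have hτ₁' : -(2 * d) < τ := by
    refine hτ₁.lt_of_ne fun h => ?_
    rw [← h] at hpos
    nlinarith
  have hτ₂' : τ < 2 * d := by
    refine hτ₂.lt_of_ne fun h => ?_
    have h₁ : P / d * (1 / 12 * (τ + d) * (τ + 2 * d) - b * σ) ≤ P / d * d ^ 2 := by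
      refine mul_le_mul_of_nonneg_left ?_ hPd.le
      rw [h]
      nlinarith
    have h₂ : P / d * d ^ 2 = P * (τ - d) := by
      rw [h]
      field_simp
      ring
    linarith
  have hσ' : σ < d ^ 2 / b := by
    refine hzσ.lt_of_ne fun h => ?_
    have h₁ : b * σ = d ^ 2 := by
      rw [h]
      field_simp
    rw [h₁] at hpos
    nlinarith
  have hDz : ∀ᶠ y in nhds z, y ∈ D := by
    have h₁ := hτ.abs.continuousAt.eventually_lt (x₀ := z) continuousAt_const
      (abs_lt.2 ⟨hτ₁', hτ₂'⟩)
    have h₂ := hσ.continuousAt.eventually_lt (x₀ := z) continuousAt_const hσ'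
    filter_upwards [h₁, h₂] with y hy₁ hy₂ using ⟨hy₁.le, hy₂.le⟩
  have hshift : ∀ y, axialQuadratic (P / d * (1 / 12 + b)) (P / d * b) (c + (u z - q z)) e x₀
      (p₀ + (P / 4) • e) y = q y + (u z - q z) := by
    intro y
    simp only [q, axialQuadratic]
    ring
  have hvisc := hu.pucciMin_le_of_eventually_le hbdd hzΩ
    (contDiff_axialQuadratic (P / d * (1 / 12 + b)) (P / d * b) (c + (u z - q z)) e x₀
      (p₀ + (P / 4) • e)) (hDz.mono fun y hy => by
        have : u z + -q z ≤ u y + -q y := hzmin hy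
        rw [hshift]
        linarith) (by rw [hshift]; ring)
  have hpucci := le_pucciMin_axialQuadratic hLam (A := P / d * (1 / 12 + b)) (B := P / d * b)
    (by positivity) (by positivity) he (c + (u z - q z)) x₀ (p₀ + (P / 4) • e) z
  have hK' := (hpucci.trans hvisc).trans (hfK z (hDball ⟨hzτ, hzσ⟩))
  have h₁ : P / d * (lam / 12) ≤ K := by
    have h₂ : P / d * (b * (n * Lam)) ≤ P / d * (lam / 24) := mul_le_mul_of_nonneg_left hbn hPd.le
    have h₃ : 0 ≤ P / d * b * lam := by positivity
    nlinarith
  rw [div_mul_eq_mul_div, le_div_iff₀ hlam]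
  rw [div_mul_eq_mul_div, div_le_iff₀ hd] at h₁
  linarith

/-! ### Measure of the set of slopes. -/

/-- The bound holds for Hausdorff measure, of which Lebesgue measure is a constant multiple. -/
theorem volume_image_le_of_lipschitzOnWith {K : ℝ≥0}
    {G : EuclideanSpace ℝ (Fin n) → EuclideanSpace ℝ (Fin n)} {s : Set (EuclideanSpace ℝ (Fin n))}
    (hG : LipschitzOnWith K G s) : volume (G '' s) ≤ (K : ℝ≥0∞) ^ n * volume s := by
  have h := hG.hausdorffMeasure_image_le
    (d := (Module.finrank ℝ (EuclideanSpace ℝ (Fin n)) : ℝ)) (Nat.cast_nonneg _)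
  have hc := Measure.isAddLeftInvariant_eq_smul
    (volume : Measure (EuclideanSpace ℝ (Fin n)))
    (Measure.hausdorffMeasure (Module.finrank ℝ (EuclideanSpace ℝ (Fin n)) : ℝ))
  rw [hc]
  simp only [Measure.smul_apply, ENNReal.smul_def, smul_eq_mul]
  rw [mul_left_comm]
  refine mul_le_mul_right ?_ _
  simpa using h

/-- Taking `y = y'` in the hypothesis makes `R` single-valued, so it is the graph of a Lipschitz
map. -/
theorem volume_relImage_le {K : ℝ≥0}
    {R : EuclideanSpace ℝ (Fin n) → EuclideanSpace ℝ (Fin n) → Prop}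
    {s : Set (EuclideanSpace ℝ (Fin n))}
    (hR : ∀ y ∈ s, ∀ y' ∈ s, ∀ p p', R y p → R y' p' → dist p p' ≤ K * dist y y') :
    volume {p | ∃ y ∈ s, R y p} ≤ (K : ℝ≥0∞) ^ n * volume s := by
  classical
  let G : EuclideanSpace ℝ (Fin n) → EuclideanSpace ℝ (Fin n) := fun y =>
    if h : ∃ p, R y p then h.choose else 0
  have hG : ∀ y, (∃ p, R y p) → R y (G y) := by
    intro y h
    simp only [G, dif_pos h]
    exact h.choose_spec
  have hLip : LipschitzOnWith K G {y ∈ s | ∃ p, R y p} :=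
    LipschitzOnWith.of_dist_le_mul fun y hy y' hy' =>
      hR y hy.1 y' hy'.1 _ _ (hG y hy.2) (hG y' hy'.2)
  refine (measure_mono ?_).trans ((volume_image_le_of_lipschitzOnWith hLip).trans
    (mul_le_mul_right (measure_mono (Set.sep_subset _ _)) _))
  rintro p ⟨y, hy, hp⟩
  refine ⟨y, ⟨hy, p, hp⟩, dist_le_zero.1 ?_⟩
  simpa using hR y hy y hy _ _ (hG y ⟨p, hp⟩) hp

theorem exists_radius_dist_slope_le {lam Lam b ε : ℝ}
    {f u : EuclideanSpace ℝ (Fin n) → ℝ} {Ω : Set (EuclideanSpace ℝ (Fin n))}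
    (hlam : 0 < lam) (hLam : lam ≤ Lam) (hb : 0 < b) (hbn : b * (n * Lam) ≤ lam / 24)
    (hΩ : IsOpen Ω) (hf : ContinuousOn f Ω)
    (hu : MemSBar lam Lam f Ω u) (hbdd : BddBelow (u '' Ω)) (hε : 0 < ε)
    {x : EuclideanSpace ℝ (Fin n)} (hx : x ∈ Ω) :
    ∃ ρ > 0, Metric.ball x ρ ⊆ Ω ∧ (∀ y ∈ Metric.ball x ρ, max (f x) 0 ≤ max (f y) 0 + ε) ∧
      ∀ y ∈ Metric.ball x ρ, ∀ y' ∈ Metric.ball x ρ, ∀ p p', IsSupportingSlope Ω u y p →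
        IsSupportingSlope Ω u y' p' → dist p p' ≤ 12 * (max (f x) 0 + ε) / lam * dist y y' := by
  have hnear : ∀ᶠ y in nhds x, y ∈ Ω ∧ |f y - f x| < ε :=
    Filter.Eventually.and (hΩ.mem_nhds hx)
      (Metric.continuousAt_iff'.1 (hf.continuousAt (hΩ.mem_nhds hx)) ε hε)
  obtain ⟨R, hR, hball⟩ := Metric.eventually_nhds_iff_ball.1 hnear
  have hκ : 0 < 4 + 1 / b := by positivity
  have hκ₁ : 1 ≤ 4 + 1 / b := by
    have : 0 < 1 / b := by positivity
    linarith
  set κ := 4 + 1 / b with hκdef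
  set r := R / 3 with hrdef
  have hr : 0 < r := by positivity
  have hρ : r / (2 * κ) ≤ r := div_le_self hr.le (by linarith)
  refine ⟨r / (2 * κ), by positivity, fun y hy => (hball y ?_).1, fun y hy => ?_, ?_⟩
  · rw [Metric.mem_ball] at hy ⊢
    linarith
  · have h := (abs_lt.1 (hball y (by rw [Metric.mem_ball] at hy ⊢; linarith)).2).1
    refine max_le ?_ ?_
    · linarith [le_max_left (f y) 0]
    · linarith [le_max_right (f y) 0]
  · intro y hy y' hy' p p' hp hp'
    have hsub : Metric.closedBall y' r ⊆ Metric.ball x R := by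
      intro z hz
      rw [Metric.mem_ball] at hy' ⊢
      rw [Metric.mem_closedBall] at hz
      linarith [dist_triangle z y' x]
    have hdist : dist y y' < r / κ := by
      rw [Metric.mem_ball] at hy hy'
      have : r / κ = r / (2 * κ) + r / (2 * κ) := by field_simp; norm_num
      linarith [dist_triangle_right y y' x]
    have hyΩ : y ∈ Ω := (hball y (by rw [Metric.mem_ball] at hy ⊢; linarith)).1
    -- The barrier needs `d > 0`, and `dist y y'` may be zero; `d` then decreases to the distance.
    have key : ∀ d ∈ Set.Ioo (dist y y') (r / κ),
        dist p p' ≤ 12 * (max (f x) 0 + ε) / lam * d := by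
      intro d hd
      have hd₀ : 0 < d := dist_nonneg.trans_lt hd.1
      rw [dist_eq_norm]
      refine norm_sub_le_of_isSupportingSlope hlam hLam hb hbn hu hbdd hyΩ
        (fun z hz => (hball z (hsub hz)).1) (fun z hz => ?_) (by positivity) hp' hp hd₀
        (by rw [← dist_eq_norm]; exact hd.1.le) hr.le ?_
      · linarith [(abs_lt.1 (hball z (hsub hz)).2).2, le_max_left (f x) 0]
      · have h := (le_div_iff₀ hκ).1 hd.2.le
        have h' : (d * κ) ^ 2 ≤ r ^ 2 := pow_le_pow_left₀ (by positivity) h 2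
        nlinarith [mul_nonneg (sq_nonneg d) (mul_nonneg hκ.le (sub_nonneg.2 hκ₁))]
    refine ge_of_tendsto (x := nhdsWithin (dist y y') (Set.Ioi (dist y y')))
      (f := fun d => 12 * (max (f x) 0 + ε) / lam * d) ?_ ?_
    · exact ((continuous_const.mul continuous_id).tendsto _).mono_left nhdsWithin_le_nhds
    · filter_upwards [Ioo_mem_nhdsGT hdist] with d hd using key d hd

theorem volume_supportingSlopes_le_add {lam Lam b ε : ℝ}
    {f u : EuclideanSpace ℝ (Fin n) → ℝ} {Ω : Set (EuclideanSpace ℝ (Fin n))}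
    (hlam : 0 < lam) (hLam : lam ≤ Lam) (hb : 0 < b) (hbn : b * (n * Lam) ≤ lam / 24)
    (hΩ : IsOpen Ω) (hf : ContinuousOn f Ω)
    (hu : MemSBar lam Lam f Ω u) (hbdd : BddBelow (u '' Ω)) (hε : 0 < ε) :
    volume {p | ∃ y ∈ Ω, IsSupportingSlope Ω u y p} ≤
      ENNReal.ofReal (12 / lam) ^ n *
        ∫⁻ x in contactSet Ω u, ENNReal.ofReal (max (f x) 0 + 2 * ε) ^ n := by
  choose! ρ hρ hρΩ hρf hρR using fun x (hx : x ∈ Ω) =>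
    exists_radius_dist_slope_le hlam hLam hb hbn hΩ hf hu hbdd hε hx
  obtain ⟨t, htΩ, htc, hcov⟩ := TopologicalSpace.countable_cover_nhdsWithin (s := Ω)
    (f := fun x => Metric.ball x (ρ x))
    fun x hx => mem_nhdsWithin_of_mem_nhds (Metric.ball_mem_nhds x (hρ x hx))
  rcases t.eq_empty_or_nonempty with rfl | htne
  · have : {p | ∃ y ∈ Ω, IsSupportingSlope Ω u y p} = ∅ := by
      ext p
      simp only [Set.mem_empty_iff_false, Set.iUnion_of_empty, Set.iUnion_empty,
        Set.subset_empty_iff] at hcov ⊢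
      simp [hcov]
    rw [this]
    simp
  obtain ⟨c, rfl⟩ := htc.exists_eq_range htne
  have hc : ∀ i, c i ∈ Ω := fun i => htΩ ⟨i, rfl⟩
  let V : ℕ → Set (EuclideanSpace ℝ (Fin n)) := fun i => Metric.ball (c i) (ρ (c i))
  let D := disjointed V
  have hDV : ∀ i, D i ⊆ V i := disjointed_subset V
  have hDm : ∀ i, MeasurableSet (D i) := fun i =>
    MeasurableSet.disjointed (fun j => Metric.isOpen_ball.measurableSet) i
  have hDd : Pairwise (Function.onFun Disjoint D) := disjoint_disjointed V
  have hDcov : Ω ⊆ ⋃ i, D i := by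
    rw [iUnion_disjointed]
    simpa [V] using hcov
  let k : ℕ → ℝ := fun i => max (f (c i)) 0 + ε
  have hk : ∀ i, 0 ≤ k i := fun i => by positivity
  let μ := volume.restrict (contactSet Ω u)
  calc volume {p | ∃ y ∈ Ω, IsSupportingSlope Ω u y p}
      ≤ volume (⋃ i, {p | ∃ y ∈ D i ∩ contactSet Ω u, IsSupportingSlope Ω u y p}) := by
        refine measure_mono ?_
        rintro p ⟨y, hy, hp⟩
        obtain ⟨i, hi⟩ := Set.mem_iUnion.1 (hDcov hy)
        exact Set.mem_iUnion.2 ⟨i, y, ⟨hi, hp.mem_contactSet hy⟩, hp⟩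
    _ ≤ ∑' i, volume {p | ∃ y ∈ D i ∩ contactSet Ω u, IsSupportingSlope Ω u y p} :=
        measure_iUnion_le _
    _ ≤ ∑' i, ENNReal.ofReal (12 / lam) ^ n *
          ∫⁻ x in D i, ENNReal.ofReal (max (f x) 0 + 2 * ε) ^ n ∂μ := by
        refine ENNReal.tsum_le_tsum fun i => ?_
        have h₁ := volume_relImage_le (K := (12 / lam * k i).toNNReal)
          (R := IsSupportingSlope Ω u) (s := D i ∩ contactSet Ω u) (by
            intro y hy y' hy' p p' hp hp'
            rw [Real.coe_toNNReal _ (mul_nonneg (by positivity) (hk i)), div_mul_eq_mul_div]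
            exact hρR (c i) (hc i) y (hDV i hy.1) y' (hDV i hy'.1) p p' hp hp')
        refine h₁.trans ?_
        have h₂ : ((12 / lam * k i).toNNReal : ℝ≥0∞) =
            ENNReal.ofReal (12 / lam) * ENNReal.ofReal (k i) :=
          ENNReal.ofReal_mul (by positivity)
        rw [h₂, mul_pow, mul_assoc]
        refine mul_le_mul_right ?_ _
        -- Only `D i` needs to be measurable here, not the contact set.
        rw [← Measure.restrict_apply (hDm i), ← setLIntegral_const]
        refine setLIntegral_mono' (hDm i) fun x hx => ?_
        refine pow_le_pow_left' (ENNReal.ofReal_le_ofReal ?_) n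
        have := hρf (c i) (hc i) x (hDV i hx)
        simp only [k]
        linarith
    _ = ENNReal.ofReal (12 / lam) ^ n *
          ∫⁻ x in ⋃ i, D i, ENNReal.ofReal (max (f x) 0 + 2 * ε) ^ n ∂μ := by
        rw [ENNReal.tsum_mul_left, lintegral_iUnion hDm hDd]
    _ ≤ _ := mul_le_mul_right (setLIntegral_le_lintegral _ _) _

theorem volume_supportingSlopes_le {lam Lam : ℝ} (hn : n ≠ 0)
    {f u : EuclideanSpace ℝ (Fin n) → ℝ} {Ω : Set (EuclideanSpace ℝ (Fin n))}
    (hlam : 0 < lam) (hLam : lam ≤ Lam) (hΩ : IsOpen Ω) (hΩfin : volume Ω ≠ ∞)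
    (hf : ContinuousOn f Ω) (hu : MemSBar lam Lam f Ω u) (hbdd : BddBelow (u '' Ω)) :
    volume {p | ∃ y ∈ Ω, IsSupportingSlope Ω u y p} ≤
      ENNReal.ofReal (24 / lam) ^ n *
        ∫⁻ x in contactSet Ω u, ENNReal.ofReal (max (f x) 0) ^ n := by
  have hLam₀ : 0 < Lam := hlam.trans_le hLam
  set b := lam / (24 * (n * Lam)) with hbdef
  have hn₀ : (0 : ℝ) < n := by positivity
  have hb : 0 < b := by positivity
  have hbn : b * (n * Lam) ≤ lam / 24 := by
    rw [hbdef]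
    field_simp
    rfl
  set I := ∫⁻ x in contactSet Ω u, ENNReal.ofReal (max (f x) 0) ^ n
  have hE : volume (contactSet Ω u) ≠ ∞ :=
    ((measure_mono fun x hx => hx.1).trans_lt hΩfin.lt_top).ne
  have key : ∀ ε ∈ Set.Ioi (0 : ℝ), volume {p | ∃ y ∈ Ω, IsSupportingSlope Ω u y p} ≤
      ENNReal.ofReal (24 / lam) ^ n *
        (I + volume (contactSet Ω u) * ENNReal.ofReal (2 * ε) ^ n) := by
    intro ε hε
    refine (volume_supportingSlopes_le_add hlam hLam hb hbn hΩ hf hu hbdd hε).trans ?_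
    -- The doubling of `12` pays for `(a + b)^n ≤ 2^n (a^n + b^n)`, which isolates the `ε` term.
    have h₁ : ENNReal.ofReal (24 / lam) ^ n = ENNReal.ofReal (12 / lam) ^ n * 2 ^ n := by
      rw [← mul_pow, ← ENNReal.ofReal_ofNat 2, ← ENNReal.ofReal_mul (by positivity)]
      congr 2
      ring
    rw [h₁, mul_assoc]
    refine mul_le_mul_right ?_ _
    have h₂ : I + volume (contactSet Ω u) * ENNReal.ofReal (2 * ε) ^ n =
        ∫⁻ x in contactSet Ω u,
          (ENNReal.ofReal (max (f x) 0) ^ n + ENNReal.ofReal (2 * ε) ^ n) := by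
      rw [lintegral_add_right _ measurable_const, lintegral_const, Measure.restrict_apply_univ,
        mul_comm]
    rw [h₂, ← lintegral_const_mul' _ _ (by finiteness)]
    refine lintegral_mono fun x => ?_
    refine (pow_le_pow_left' ENNReal.ofReal_add_le n).trans ?_
    rcases le_total (ENNReal.ofReal (max (f x) 0)) (ENNReal.ofReal (2 * ε)) with h | h
    · refine (pow_le_pow_left' (add_le_add_left h _) n).trans ?_
      rw [← two_mul, mul_pow]
      exact mul_le_mul_right le_add_self _
    · refine (pow_le_pow_left' (add_le_add_right h _) n).trans ?_
      rw [← two_mul, mul_pow]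
      exact mul_le_mul_right le_self_add _
  refine ge_of_tendsto (x := nhdsWithin (0 : ℝ) (Set.Ioi 0))
    (f := fun ε => ENNReal.ofReal (24 / lam) ^ n *
        (I + volume (contactSet Ω u) * ENNReal.ofReal (2 * ε) ^ n)) ?_
    (Filter.eventually_of_mem self_mem_nhdsWithin key)
  have h₀ : Filter.Tendsto (fun ε : ℝ => ENNReal.ofReal (2 * ε) ^ n) (nhds 0) (nhds 0) := by
    have : Continuous fun ε : ℝ => ENNReal.ofReal (2 * ε) ^ n :=
      (ENNReal.continuous_pow n).comp (ENNReal.continuous_ofReal.comp (by fun_prop))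
    simpa [hn] using this.tendsto 0
  have h₁ := ENNReal.Tendsto.const_mul (h₀.mono_left (nhdsWithin_le_nhds (s := Set.Ioi 0)))
    (Or.inr hE)
  have h₂ := ENNReal.Tendsto.const_mul (a := ENNReal.ofReal (24 / lam) ^ n)
    (tendsto_const_nhds (x := I).add h₁) (Or.inr (by finiteness))
  simpa using h₂

/-! ### Existence of slopes and conclusion. -/

/-- Minimizing `u - p · x` over the closure yields an interior contact point, provided `p` is too
small for contact where `u` is bounded below by `-k` and too transversal for contact on `Γ`. -/
theorem exists_isSupportingSlope {k : ℝ} {Ω Γ : Set (EuclideanSpace ℝ (Fin n))}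
    {u γ g : EuclideanSpace ℝ (Fin n) → ℝ}
    {β : EuclideanSpace ℝ (Fin n) → EuclideanSpace ℝ (Fin n)}
    (hΩ₁ : Ω ⊆ Metric.ball 0 1) (hu : LowerSemicontinuousOn u (closure Ω))
    (hob : ObliqueLE β γ g Ω Γ u) (hΓ : Γ ⊆ frontier Ω) (hγ : ∀ x ∈ Γ, γ x ≤ 0) (hk : 0 ≤ k)
    (hbd : ∀ x ∈ frontier Ω \ Γ, -k ≤ u x) {x₀ p : EuclideanSpace ℝ (Fin n)} (hx₀ : x₀ ∈ Ω)
    (hp : 2 * ‖p‖ < -u x₀ - k) (hpβ : ∀ x ∈ Γ, g x < inner ℝ p (β x)) :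
    ∃ y ∈ Ω, IsSupportingSlope Ω u y p := by
  have hclos : closure Ω ⊆ Metric.closedBall 0 1 :=
    closure_minimal (hΩ₁.trans Metric.ball_subset_closedBall) Metric.isClosed_closedBall
  have hcomp : IsCompact (closure Ω) :=
    (isCompact_closedBall 0 1).of_isClosed_subset isClosed_closure hclos
  have hlsc : LowerSemicontinuousOn (fun z => u z + -inner ℝ p z) (closure Ω) :=
    hu.add (continuous_const.inner continuous_id).neg.continuousOn.lowerSemicontinuousOn
  obtain ⟨y, hy, hmin⟩ := hlsc.exists_isMinOn ⟨x₀, subset_closure hx₀⟩ hcomp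
  have hsupp : ∀ z ∈ closure Ω, u y + inner ℝ p (z - y) ≤ u z := by
    intro z hz
    have : u y + -inner ℝ p y ≤ u z + -inner ℝ p z := hmin hz
    rw [inner_sub_right]
    linarith
  have hyneg : u y < -k := by
    have h₁ := hsupp x₀ (subset_closure hx₀)
    have h₂ : |inner ℝ p (x₀ - y)| ≤ ‖p‖ * 2 := by
      refine (abs_real_inner_le_norm _ _).trans (mul_le_mul_of_nonneg_left ?_ (norm_nonneg p))
      have h₃ := mem_closedBall_zero_iff.1 (hclos hy)
      have h₄ := mem_closedBall_zero_iff.1 (hclos (subset_closure hx₀))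
      linarith [norm_sub_le x₀ y]
    linarith [(abs_le.1 h₂).1]
  by_cases hyΩ : y ∈ Ω
  · exact ⟨y, hyΩ, fun z hz => hsupp z (subset_closure hz)⟩
  have hyfr : y ∈ frontier Ω := ⟨hy, fun h => hyΩ (interior_subset h)⟩
  by_cases hyΓ : y ∈ Γ
  · exfalso
    let φ : EuclideanSpace ℝ (Fin n) → ℝ := fun z => innerSL ℝ p z + (u y - inner ℝ p y)
    have hφy : φ y = u y := by simp [φ]
    have hφd : fderiv ℝ φ y = innerSL ℝ p := ((innerSL ℝ p).hasFDerivAt.add_const _).fderiv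
    have h := hob.2 φ y
      (fun z _ => ((innerSL ℝ p).contDiff.add contDiff_const).contDiffAt) hyΓ
      ⟨Or.inr hyΓ, fun z hz => ?_, hφy⟩
    · rw [hφd, hφy, innerSL_apply_apply] at h
      -- Since `u y < -k ≤ 0` and `γ ≤ 0`, the zeroth-order term is nonnegative and `p · β ≤ g`, a
      -- contradiction.
      nlinarith [hpβ y hyΓ, hγ y hyΓ]
    · have := hsupp z (hz.elim (fun h => subset_closure h) fun h => frontier_subset_closure (hΓ h))
      rw [inner_sub_right] at this
      simp only [φ, innerSL_apply_apply]
      linarith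
  · linarith [hbd y ⟨hyfr, hyΓ⟩]

/-- The constant in the maximum principle attached to the `L^n` norm of `f⁺`. -/
noncomputable def abpConst (n : ℕ) (lam δ₁ : ℝ) : ℝ≥0∞ :=
  ENNReal.ofReal (24 / lam) / (ENNReal.ofReal (min δ₁ 1 / 8) *
    volume (Metric.ball (0 : EuclideanSpace ℝ (Fin n)) 1) ^ (1 / n : ℝ))

theorem abpConst_ne_top (n : ℕ) (lam : ℝ) {δ₁ : ℝ} (hδ₁ : 0 < δ₁) : abpConst n lam δ₁ ≠ ∞ := by
  have h : 0 < volume (Metric.ball (0 : EuclideanSpace ℝ (Fin n)) 1) :=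
    Metric.measure_ball_pos _ _ one_pos
  refine ENNReal.div_ne_top ENNReal.ofReal_ne_top (mul_ne_zero ?_ ?_)
  · have : 0 < min δ₁ 1 / 8 := by positivity
    simpa using this
  · exact (ENNReal.rpow_pos h measure_ball_lt_top.ne).ne'

theorem ofReal_le_abpConst_mul_eLpNorm {lam δ₁ M : ℝ} (hn : n ≠ 0) (hδ₁ : 0 < δ₁) (hM : 0 < M)
    {F : EuclideanSpace ℝ (Fin n) → ℝ} (hF : ∀ x, 0 ≤ F x)
    {μ : Measure (EuclideanSpace ℝ (Fin n))} {x : EuclideanSpace ℝ (Fin n)}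
    (h : volume (Metric.ball x (min δ₁ 1 / 8 * M)) ≤
      ENNReal.ofReal (24 / lam) ^ n * ∫⁻ x, ENNReal.ofReal (F x) ^ n ∂μ) :
    ENNReal.ofReal M ≤ abpConst n lam δ₁ * eLpNorm F n μ := by
  have hκ : 0 < min δ₁ 1 / 8 := by positivity
  set ω := volume (Metric.ball (0 : EuclideanSpace ℝ (Fin n)) 1) with hω
  have hω₀ : 0 < ω := Metric.measure_ball_pos _ _ one_pos
  have hω₁ : ω ≠ ∞ := measure_ball_lt_top.ne
  have hωn : (ω ^ (1 / n : ℝ)) ^ n = ω := by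
    rw [one_div]
    exact ENNReal.rpow_inv_natCast_pow hn ω
  have hI : ∫⁻ x, ENNReal.ofReal (F x) ^ n ∂μ = eLpNorm F n μ ^ n := by
    have h₁ := eLpNorm_nnreal_pow_eq_lintegral (f := F) (μ := μ) (p := (n : ℝ≥0)) (by simpa using hn)
    simp only [NNReal.coe_natCast, ENNReal.rpow_natCast, ENNReal.coe_natCast] at h₁
    rw [h₁]
    exact lintegral_congr fun x => by rw [Real.enorm_of_nonneg (hF x)]
  rw [Measure.addHaar_ball_of_pos _ _ (by positivity), hI, finrank_euclideanSpace_fin,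
    ENNReal.ofReal_pow (by positivity), ENNReal.ofReal_mul hκ.le, ← hω, ← hωn, ← mul_pow, ← mul_pow]
    at h
  have h' := (ENNReal.pow_le_pow_left_iff hn).1 h
  have hden : ENNReal.ofReal (min δ₁ 1 / 8) * ω ^ (1 / n : ℝ) ≠ 0 :=
    mul_ne_zero (by simpa using hκ) (ENNReal.rpow_pos hω₀ hω₁).ne'
  have hden' : ENNReal.ofReal (min δ₁ 1 / 8) * ω ^ (1 / n : ℝ) ≠ ∞ :=
    ENNReal.mul_ne_top ENNReal.ofReal_ne_top (ENNReal.rpow_ne_top_of_nonneg (by positivity) hω₁)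
  rw [abpConst, ← hω, ENNReal.mul_comm_div, ← mul_div_assoc,
    ENNReal.le_div_iff_mul_le (Or.inl hden) (Or.inl hden')]
  calc ENNReal.ofReal M * (ENNReal.ofReal (min δ₁ 1 / 8) * ω ^ (1 / n : ℝ))
      = ENNReal.ofReal (min δ₁ 1 / 8) * ENNReal.ofReal M * ω ^ (1 / n : ℝ) := by ring
    _ ≤ _ := h'

end

theorem theorem2p3 (n : ℕ) (lam Lam δ₁ : ℝ) (hlam : 0 < lam) (hLam : lam ≤ Lam) (hδ₁ : 0 < δ₁) :
    ∃ C : ℝ≥0, 0 < C ∧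
      ∀ (Ω Γ : Set (EuclideanSpace ℝ (Fin n)))
        (u f : EuclideanSpace ℝ (Fin n) → ℝ)
        (β : EuclideanSpace ℝ (Fin n) → EuclideanSpace ℝ (Fin n))
        (γ g : EuclideanSpace ℝ (Fin n) → ℝ)
        (ξ : EuclideanSpace ℝ (Fin n)),
        IsOpen Ω → Ω ⊆ Metric.ball 0 1 → Γ ⊆ frontier Ω →
        ContinuousOn f Ω →
        (∀ x ∈ Γ, ‖β x‖ ≤ 1) →
        LowerSemicontinuousOn u (closure Ω) →
        MemSBar lam Lam f Ω u →
        ObliqueLE β γ g Ω Γ u →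
        (∀ x ∈ Γ, γ x ≤ 0) →
        ‖ξ‖ = 1 → (∀ x ∈ Γ, δ₁ ≤ inner ℝ (β x) ξ) →
        supNeg Ω u ≤ supNeg (frontier Ω \ Γ) u + C * supPos Γ g
          + C * eLpNorm (fun x => max (f x) 0) (n : ℝ≥0∞) (volume.restrict (contactSet Ω u)) := by
  refine ⟨(8 / δ₁).toNNReal + (abpConst n lam δ₁).toNNReal,
    add_pos_of_pos_of_nonneg (by simpa using hδ₁) zero_le, ?_⟩
  intro Ω Γ u f β γ g ξ hΩ hΩ₁ hΓ hf hβ hlsc hu hob hγ hξ hβξ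
  have hn : n ≠ 0 := by
    rintro rfl
    rw [Subsingleton.elim ξ 0, norm_zero] at hξ
    exact zero_ne_one hξ
  set C : ℝ≥0 := (8 / δ₁).toNNReal + (abpConst n lam δ₁).toNNReal with hC
  have hC₁ : ENNReal.ofReal (8 / δ₁) ≤ C := ENNReal.coe_le_coe.2 le_self_add
  have hC₂ : abpConst n lam δ₁ ≤ C := by
    rw [← ENNReal.coe_toNNReal (abpConst_ne_top n lam hδ₁)]
    exact ENNReal.coe_le_coe.2 le_add_self
  by_cases hfin : supNeg (frontier Ω \ Γ) u = ∞
  · simp [hfin]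
  refine iSup₂_le fun x₀ hx₀ => ?_
  set k := (supNeg (frontier Ω \ Γ) u).toReal with hkdef
  have hk : 0 ≤ k := ENNReal.toReal_nonneg
  have hbd : ∀ x ∈ frontier Ω \ Γ, -k ≤ u x := by
    intro x hx
    have h₁ : ENNReal.ofReal (-min 0 (u x)) ≤ supNeg (frontier Ω \ Γ) u :=
      le_iSup₂ (f := fun x _ => ENNReal.ofReal (-min 0 (u x))) x hx
    have h₂ := (ENNReal.ofReal_le_iff_le_toReal hfin).1 h₁
    linarith [min_le_right 0 (u x)]
  set M := -min 0 (u x₀) - k with hMdef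
  have hsplit : ENNReal.ofReal (-min 0 (u x₀)) ≤ supNeg (frontier Ω \ Γ) u + ENNReal.ofReal M := by
    rw [← ENNReal.ofReal_toReal hfin, ← hkdef]
    refine le_trans (le_of_eq ?_) ENNReal.ofReal_add_le
    congr 1
    rw [hMdef]
    ring
  refine hsplit.trans ?_
  rw [add_assoc]
  refine add_le_add_right ?_ _
  rcases le_or_gt M 0 with hM | hM
  · simp [ENNReal.ofReal_of_nonpos hM]
  have hMu : M = -u x₀ - k := by
    rcases le_total 0 (u x₀) with h | h
    · rw [min_eq_left h] at hMdef
      linarith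
    · rw [hMdef, min_eq_right h]
  -- Either `g⁺` alone controls `M`, or `g ≤ M δ₁ / 8` throughout `Γ`.
  by_cases hg : ENNReal.ofReal (M * δ₁ / 8) < supPos Γ g
  · refine le_add_right ?_
    calc ENNReal.ofReal M = ENNReal.ofReal (8 / δ₁) * ENNReal.ofReal (M * δ₁ / 8) := by
          rw [← ENNReal.ofReal_mul (by positivity)]
          congr 1
          field_simp
      _ ≤ C * supPos Γ g := mul_le_mul' hC₁ hg.le
  refine le_add_left (le_trans ?_ (mul_le_mul_left hC₂ _))
  have hgle : ∀ x ∈ Γ, g x ≤ M * δ₁ / 8 := by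
    intro x hx
    have h₁ : ENNReal.ofReal (max (g x) 0) ≤ supPos Γ g :=
      le_iSup₂ (f := fun x _ => ENNReal.ofReal (max (g x) 0)) x hx
    have h₂ := (ENNReal.ofReal_le_ofReal_iff (by positivity)).1 (h₁.trans (not_lt.1 hg))
    exact (le_max_left _ _).trans h₂
  have hbdd : BddBelow (u '' Ω) := by
    have hcomp : IsCompact (closure Ω) :=
      (Metric.isBounded_ball.subset hΩ₁).isCompact_closure
    exact (hlsc.bddBelow_of_isCompact hcomp).mono (Set.image_mono subset_closure)
  -- Here `‖p‖ < M / 4 + M / 8 < M / 2`, and `p · β > M δ₁ / 4 - M δ₁ / 8 ≥ g`.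
  have hslopes : Metric.ball ((M / 4) • ξ) (min δ₁ 1 / 8 * M) ⊆
      {p | ∃ y ∈ Ω, IsSupportingSlope Ω u y p} := by
    intro p hp
    rw [mem_ball_iff_norm] at hp
    have h₁ : min δ₁ 1 / 8 * M ≤ M / 8 := by nlinarith [min_le_right δ₁ 1]
    have h₂ : min δ₁ 1 / 8 * M ≤ M * δ₁ / 8 := by nlinarith [min_le_left δ₁ 1]
    refine exists_isSupportingSlope hΩ₁ hlsc hob hΓ hγ hk hbd hx₀ ?_ fun x hx => ?_
    · have h₃ : ‖(M / 4) • ξ‖ = M / 4 := by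
        rw [norm_smul, hξ, mul_one, Real.norm_of_nonneg (by positivity)]
      have h₄ := norm_le_norm_sub_add p ((M / 4) • ξ)
      linarith
    · have h₃ : inner ℝ p (β x) = inner ℝ (p - (M / 4) • ξ) (β x) + M / 4 * inner ℝ (β x) ξ := by
        rw [inner_sub_left, inner_smul_left, real_inner_comm ξ]
        simp
      have h₄ := (abs_real_inner_le_norm (p - (M / 4) • ξ) (β x)).trans
        (mul_le_of_le_one_right (norm_nonneg _) (hβ x hx))
      have h₅ := mul_le_mul_of_nonneg_left (hβξ x hx) (by positivity : 0 ≤ M / 4)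
      linarith [hgle x hx, (abs_le.1 h₄).1]
  exact ofReal_le_abpConst_mul_eLpNorm hn hδ₁ hM (fun x => le_max_right _ _)
    ((measure_mono hslopes).trans (volume_supportingSlopes_le hn hlam hLam hΩ
      ((measure_mono hΩ₁).trans_lt measure_ball_lt_top).ne hf hu hbdd))
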